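/- Let $\mathcal H$ be a real Hilbert space, let $f\colon\mathcal H\to\,]-\infty,+\infty]$ be proper, lower semicontinuous and convex, let $f^*(u)=\sup_{x\in\mathcal H}(\langle x,u\rangle-f(x))$ be its conjugate, and let $(\operatorname{rec}f)(x)=\lim_{t\to+\infty}\frac{f(x_0+tx)-f(x_0)}{t}$ (for any $x_0\in\operatorname{dom}f$) be its recession function. The perspective of $f$ is the function $\widetilde f$ on the Hilbert direct sum $\mathcal H\oplus\mathbb R$ given by $\widetilde f(x,\eta)=\eta f(x/\eta)$ if $\eta>0$, $\widetilde f(x,0)=(\operatorname{rec}f)(x)$, and $\widetilde f(x,\eta)=+\infty$ if $\eta<0$. Write $P_C$ for the projection onto a nonempty closed convex set $C$, $\operatorname{prox}_g(z)$ for the minimizer of $y\mapsto g(y)+\frac12\|z-y\|^2$, and $\operatorname{epi}\widetilde f=\{(x,\eta,\delta)\in\mathcal H\oplus\mathbb R\oplus\mathbb R:\widetilde f(x,\eta)\le\delta\}$. Let $(x,\eta,\delta)\in\mathcal H\times\mathbb R^2$ be such that $\widetilde f\big(P_{\overline{\operatorname{dom}}\,\widetilde f}(x,\eta)\big)>\delta$,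 let $\varepsilon>0$ and let $N>1$ be real. **Algorithm.** Set $\mu_-^0=0$. Set $\mu_+^0=-\delta+\widetilde f\big(P_{\overline{\operatorname{dom}}\,\widetilde f}(x,\eta)\big)$ if this is finite, and otherwise $\mu_+^0=N^k$, where $k\in\{0,1,2,\dots\}$ is the first integer such that $N^k+\delta-\widetilde f\big(\operatorname{prox}_{N^k\widetilde f}(x,\eta)\big)>0$. Set $m=\max\{0,\lfloor\log_2(\mu_+^0/\varepsilon)\rfloor\}$. For $n=0,\dots,m$, put $\mu=\hat\mu^{n+1}=\frac{\mu_+^n+\mu_-^n}{2}$ and do the following. - If $\eta+\mu f^*\big(P_{\overline{\operatorname{dom}}f^*}(x/\mu)\big)\le0$, set $(\bar x,\bar\eta)=(\operatorname{prox}_{\mu\operatorname{rec}f}x,\,0)$ and $v=(\operatorname{rec}f)(\bar x)$. - Otherwise let $\nu$ be the unique solution of $\nu=\eta+\mu f^*\big(\operatorname{prox}_{\frac\nu\mu f^*}(x/\mu)\big)$ in $\big]0,\eta+\mu f^*(P_{\overline{\operatorname{dom}}f^*}(x/\mu))\big]\cap\mathbb R$, and set $(\bar x,\bar\eta)=\big(\nu\operatorname{prox}_{\frac\mu\nu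 f}(x/\nu),\,\nu\big)$ and $v=\bar\eta f(\bar x/\bar\eta)$. - If $\mu+\delta-v>0$, set $(\mu_-^{n+1},\mu_+^{n+1})=(\mu_-^n,\mu)$; otherwise set $(\mu_-^{n+1},\mu_+^{n+1})=(\mu,\mu_+^n)$. The output is $(\bar x,\bar\eta,\bar\delta)$, where $(\bar x,\bar\eta)$ is the pair computed in the last pass ($n=m$) and $\bar\delta=\delta+\hat\mu^{m+1}$. **Theorem.** Let $(x^*,\eta^*,\delta^*)=P_{\operatorname{epi}\widetilde f}(x,\eta,\delta)$, and let $(\bar x,\bar\eta,\bar\delta)$ be the output of the algorithm. Then $$|\delta^*-\bar\delta|\le\varepsilon\qquad\text{and}\qquad\|(x^*,\eta^*)-(\bar x,\bar\eta)\|\le\frac{\varepsilon}{\bar\delta-\delta}\,\|(x,\eta)-(\bar x,\bar\eta)\|.$$ -/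

import Mathlib

open Filter Topology

noncomputable section

namespace EpiPersp

section General

variable {E : Type*} [NormedAddCommGroup E] [InnerProductSpace ℝ E]

/-- The domain of an extended-real-valued function. -/
def dom (g : E → EReal) : Set E := {x | g x < ⊤}

/-- The epigraph of `g`, as a subset of the Hilbert direct sum `E ⊕ ℝ`. -/
def epi (g : E → EReal) : Set (WithLp 2 (E × ℝ)) := {p | g p.fst ≤ (p.snd : EReal)}

/-- `g` belongs to `Γ₀(E)`: values in `]-∞, +∞]`, proper, lower semicontinuous and convex
(a function with values in `]-∞, +∞]` is convex when its epigraph is convex). -/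
structure Gamma0 (g : E → EReal) : Prop where
  ne_bot : ∀ x, g x ≠ ⊥
  proper : (dom g).Nonempty
  lsc : LowerSemicontinuous g
  convex : Convex ℝ (epi g)

/-- The function `c g`, used for real `c > 0`. -/
def scale (c : ℝ) (g : E → EReal) : E → EReal := fun x => (c : EReal) * g x

/-- The conjugate `g*(u) = sup_x (⟨x, u⟩ - g x)`. -/
def conj (g : E → EReal) : E → EReal :=
  fun u => ⨆ x : E, ((inner ℝ x u : ℝ) : EReal) - g x

/-- The recession function: `rec g x` is the common limit, over all base points `x₀ ∈ dom g`,
of `(g (x₀ + t x) - g x₀) / t` as `t → +∞`. -/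
def recession (g : E → EReal) : E → EReal := fun x =>
  Classical.epsilon fun l : EReal =>
    ∀ x₀ ∈ dom g, Tendsto (fun t : ℝ => (g (x₀ + t • x) - g x₀) / (t : EReal)) atTop (𝓝 l)

/-- The proximity operator: the minimizer of `y ↦ g y + ‖x - y‖² / 2`. -/
def prox (g : E → EReal) (x : E) : E :=
  Classical.epsilon fun p : E =>
    ∀ y : E, g p + ((1 / 2 * ‖x - p‖ ^ 2 : ℝ) : EReal) ≤ g y + ((1 / 2 * ‖x - y‖ ^ 2 : ℝ) : EReal)

/-- The projection onto `C`: the point of `C` nearest to `x`. -/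
def proj (C : Set E) (x : E) : E :=
  Classical.epsilon fun p : E => p ∈ C ∧ ∀ y ∈ C, ‖x - p‖ ≤ ‖x - y‖

end General

section Perspective

variable {H : Type*} [NormedAddCommGroup H] [InnerProductSpace ℝ H]

/-- The perspective of `f`, a function on the Hilbert direct sum `H ⊕ ℝ`. -/
def persp (f : H → EReal) : WithLp 2 (H × ℝ) → EReal := fun p =>
  if 0 < p.snd then (p.snd : EReal) * f (p.snd⁻¹ • p.fst)
  else if p.snd = 0 then recession f p.fst
  else ⊤

/-- The point `P_{cl dom f̃}(x, η)`. -/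
def projDom (f : H → EReal) (x : H) (η : ℝ) : WithLp 2 (H × ℝ) :=
  proj (closure (dom (persp f))) (WithLp.toLp 2 (x, η))

/-- `φ(μ) = μ + δ - f̃(prox_{μ f̃}(x, η))`, for `μ > 0`. -/
def phi (f : H → EReal) (x : H) (η δ μ : ℝ) : EReal :=
  ((μ + δ : ℝ) : EReal) - persp f (prox (scale μ (persp f)) (WithLp.toLp 2 (x, η)))

/-- `η + μ f*(P_{cl dom f*}(x / μ))`, for `μ > 0`. -/
def threshold (f : H → EReal) (x : H) (η μ : ℝ) : EReal :=
  (η : EReal) + (μ : EReal) * conj f (proj (closure (dom (conj f))) (μ⁻¹ • x))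

/-- `ψ_μ(ν) = ν - η - μ f*(prox_{(ν/μ) f*}(x / μ))`, for `μ, ν > 0`. -/
def psi (f : H → EReal) (x : H) (η μ ν : ℝ) : EReal :=
  ((ν - η : ℝ) : EReal) - (μ : EReal) * conj f (prox (scale (ν / μ) (conj f)) (μ⁻¹ • x))

/-- The zero of `ψ_μ` in `]0, η + μ f*(P_{cl dom f*}(x / μ))] ∩ ℝ`. -/
def nuRoot (f : H → EReal) (x : H) (η μ : ℝ) : ℝ :=
  Classical.epsilon fun ν : ℝ => 0 < ν ∧ (ν : EReal) ≤ threshold f x η μ ∧ psi f x η μ ν = 0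

open Classical in
/-- The pair `(x̄, η̄)` which the body of the loop computes from the midpoint `μ`. -/
def loopPoint (f : H → EReal) (x : H) (η μ : ℝ) : H × ℝ :=
  if threshold f x η μ ≤ 0 then
    (prox (scale μ (recession f)) x, 0)
  else
    (nuRoot f x η μ • prox (scale (μ / nuRoot f x η μ) f) ((nuRoot f x η μ)⁻¹ • x),
      nuRoot f x η μ)

open Classical in
/-- The quantity whose sign the body of the loop tests: `μ + δ - (rec f)(x̄)` in the first branch,
`μ + δ - η̄ f(x̄ / η̄)` in the second one. -/
def loopTest (f : H → EReal) (x : H) (η δ μ : ℝ) : EReal :=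
  if threshold f x η μ ≤ 0 then
    ((μ + δ : ℝ) : EReal) - recession f (loopPoint f x η μ).1
  else
    ((μ + δ : ℝ) : EReal) - ((loopPoint f x η μ).2 : EReal) *
      f ((loopPoint f x η μ).2⁻¹ • (loopPoint f x η μ).1)

open Classical in
/-- The initial right end point `μ₊⁰`: `-δ + f̃(P_{cl dom f̃}(x, η))` if this is finite, and
otherwise `N ^ k` for the first `k` with `φ(N ^ k) > 0`. -/
def muInit (f : H → EReal) (x : H) (η δ N : ℝ) : ℝ :=
  if projDom f x η ∈ dom (persp f) then
    -δ + (persp f (projDom f x η)).toReal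
  else
    N ^ sInf {k : ℕ | 0 < phi f x η δ (N ^ k)}

open Classical in
/-- The bracket `(μ₋ⁿ, μ₊ⁿ)` at the start of the pass `n` through the loop. -/
def bracket (f : H → EReal) (x : H) (η δ N : ℝ) : ℕ → ℝ × ℝ
  | 0 => (0, muInit f x η δ N)
  | n + 1 =>
    let s := bracket f x η δ N n
    let μ := (s.2 + s.1) / 2
    if 0 < loopTest f x η δ μ then (s.1, μ) else (μ, s.2)

/-- The midpoint `μ̂ⁿ⁺¹ = (μ₊ⁿ + μ₋ⁿ) / 2`. -/
def midpt (f : H → EReal) (x : H) (η δ N : ℝ) (n : ℕ) : ℝ :=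
  ((bracket f x η δ N n).2 + (bracket f x η δ N n).1) / 2

/-- The index `m` of the last pass: the integer part of `log₂ (μ₊⁰ / ε)`, or `0` if that is
negative (the loop is passed through at least once). -/
def lastIndex (f : H → EReal) (x : H) (η δ N ε : ℝ) : ℕ :=
  ⌊Real.logb 2 (muInit f x η δ N / ε)⌋₊

/-- The output `((x̄, η̄), δ̄)` of the bisection algorithm with tolerance `ε`. -/
def bisection (f : H → EReal) (x : H) (η δ N ε : ℝ) : WithLp 2 (WithLp 2 (H × ℝ) × ℝ) :=
  let μ := midpt f x η δ N (lastIndex f x η δ N ε)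
  WithLp.toLp 2 (WithLp.toLp 2 (loopPoint f x η μ), δ + μ)

end Perspective

end EpiPersp

end

noncomputable section

namespace EpiPersp

/-! Write g for the perspective of f and z = (x, η). The projection of (z, δ) onto epi g either
keeps the last coordinate or raises it by some μ* > 0. The assumption on δ excludes the former, and
in the latter (x*, η*) = prox_{μ* g} z with g(prox_{μ* g} z) = δ + μ* (`exists_proj_epi`). Since c ↦
g(prox_{c g} z) is nonincreasing (`IsResolvent.antitone`), φ(μ) = μ + δ - g(prox_{μ g} z) is
strictly increasing, so its sign locates μ relative to its zero μ*.

The loop computes exactly this prox (`exists_isResolvent_loopPoint`): g is the support function of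
{(u, -b) | f* u ≤ b}, so Moreau's decomposition reduces prox_{μ g} z to projecting (x/μ, -η/μ) onto
epi f*, and the two branches of the loop are the two cases of that projection. Bisection bounds |δ*
- δ̄|, and the dependence of prox_{c g} z on c (`IsResolvent.norm_sub_le`) turns this into the bound
on the points.

Proximal points and conjugates are handled through inequalities over real s ≥ g y, which mostly
avoids extended-real arithmetic. -/

theorem mem_dom_of_le {E : Type*} {g : E → EReal} {y : E} {s : ℝ} (h : g y ≤ s) : y ∈ dom g :=
  h.trans_lt (EReal.coe_lt_top s)

/-! ### Convex analysis in a Hilbert space -/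

section Hilbert

variable {E : Type*} [NormedAddCommGroup E] [InnerProductSpace ℝ E]

theorem exists_real_of_lt_top {a : EReal} (h : a ≠ ⊥) (h' : a < ⊤) : ∃ r : ℝ, a = r :=
  ⟨a.toReal, (EReal.coe_toReal h'.ne h).symm⟩

theorem exists_real_of_le {a : EReal} (h : a ≠ ⊥) {s : ℝ} (h' : a ≤ s) :
    ∃ r : ℝ, a = r ∧ r ≤ s := by
  obtain ⟨r, hr⟩ := exists_real_of_lt_top h (h'.trans_lt (EReal.coe_lt_top s))
  exact ⟨r, hr, by simpa [hr] using h'⟩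

/-! ### Projections -/

/-- The nearest point is characterized by a variational inequality. -/
theorem proj_eq {C : Set E} {x p : E} (hp : p ∈ C)
    (h : ∀ y ∈ C, inner ℝ (x - p) (y - p) ≤ 0) : proj C x = p := by
  have key : ∀ y ∈ C, ‖x - p‖ ^ 2 + ‖y - p‖ ^ 2 ≤ ‖x - y‖ ^ 2 := by
    intro y hy
    have h1 := h y hy
    have h2 := norm_sub_sq_real (x - p) (y - p)
    rw [sub_sub_sub_cancel_right] at h2
    linarith
  have hs : p ∈ C ∧ ∀ y ∈ C, ‖x - p‖ ≤ ‖x - y‖ := by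
    refine ⟨hp, fun y hy => ?_⟩
    have := key y hy
    exact (sq_le_sq₀ (norm_nonneg _) (norm_nonneg _)).1 (by nlinarith [sq_nonneg ‖y - p‖])
  -- `proj` is only a choice of a nearest point; `key` at the chosen point forces it to be p.
  have h3 : proj C x ∈ C ∧ ∀ y ∈ C, ‖x - proj C x‖ ≤ ‖x - y‖ :=
    Classical.epsilon_spec (p := fun q : E => q ∈ C ∧ ∀ y ∈ C, ‖x - q‖ ≤ ‖x - y‖) ⟨p, hs⟩
  have h4 := key _ h3.1
  have h5 := pow_le_pow_left₀ (norm_nonneg _) (h3.2 p hp) 2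
  have h6 : ‖proj C x - p‖ ^ 2 = 0 := le_antisymm (by linarith) (sq_nonneg _)
  exact sub_eq_zero.1 (norm_eq_zero.1 (pow_eq_zero_iff two_ne_zero |>.1 h6))

theorem exists_inner_le_zero [CompleteSpace E] {C : Set E} (hne : C.Nonempty) (hcl : IsClosed C)
    (hc : Convex ℝ C) (x : E) : ∃ p ∈ C, ∀ y ∈ C, inner ℝ (x - p) (y - p) ≤ 0 := by
  obtain ⟨p, hp, h⟩ := exists_norm_eq_iInf_of_complete_convex hne hcl.isComplete hc x
  exact ⟨p, hp, (norm_eq_iInf_iff_real_inner_le_zero hc hp).1 h⟩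

theorem proj_spec [CompleteSpace E] {C : Set E} (hne : C.Nonempty) (hcl : IsClosed C)
    (hc : Convex ℝ C) (x : E) :
    proj C x ∈ C ∧ ∀ y ∈ C, inner ℝ (x - proj C x) (y - proj C x) ≤ 0 := by
  obtain ⟨p, hp, h⟩ := exists_inner_le_zero hne hcl hc x
  rw [proj_eq hp h]
  exact ⟨hp, h⟩

/-! ### Epigraphs and domains -/

theorem Gamma0.convex_comb {g : E → EReal} (hg : Gamma0 g) {y z : E} {s t a b : ℝ}
    (hy : g y ≤ s) (hz : g z ≤ t) (ha : 0 ≤ a) (hb : 0 ≤ b) (hab : a + b = 1) :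
    g (a • y + b • z) ≤ ((a * s + b * t : ℝ) : EReal) :=
  hg.convex (show WithLp.toLp 2 (y, s) ∈ epi g from hy) (show WithLp.toLp 2 (z, t) ∈ epi g from hz)
    ha hb hab

theorem Gamma0.exists_le {g : E → EReal} (hg : Gamma0 g) : ∃ (y : E) (s : ℝ), g y ≤ s := by
  obtain ⟨y, hy⟩ := hg.proper
  obtain ⟨r, hr⟩ := exists_real_of_lt_top (hg.ne_bot y) hy
  exact ⟨y, r, hr.le⟩

theorem Gamma0.isClosed_epi {g : E → EReal} (hg : Gamma0 g) : IsClosed (epi g) := by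
  have h := hg.lsc.isClosed_epigraph
  have hc : Continuous fun p : WithLp 2 (E × ℝ) => (p.fst, (p.snd : EReal)) := by
    have h1 : Continuous fun p : WithLp 2 (E × ℝ) => p.fst := by fun_prop
    have h2 : Continuous fun p : WithLp 2 (E × ℝ) => p.snd := by fun_prop
    exact h1.prodMk (continuous_coe_real_ereal.comp h2)
  exact h.preimage hc

theorem Gamma0.convex_dom {g : E → EReal} (hg : Gamma0 g) : Convex ℝ (dom g) := by
  intro y hy z hz a b ha hb hab
  obtain ⟨s, hs⟩ := exists_real_of_lt_top (hg.ne_bot y) hy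
  obtain ⟨t, ht⟩ := exists_real_of_lt_top (hg.ne_bot z) hz
  exact (hg.convex_comb hs.le ht.le ha hb hab).trans_lt (EReal.coe_lt_top _)

/-- A function whose real upper bounds are cut out by continuous affine functions. -/
theorem Gamma0.of_le_iff {g : E → EReal} {ι : Type*} [Nonempty ι] (a : ι → E) (c : ι → ℝ)
    (h : ∀ p (t : ℝ), g p ≤ t ↔ ∀ i, inner ℝ p (a i) + c i ≤ t) (hp : (dom g).Nonempty) :
    Gamma0 g := by
  have hbot : ∀ x, g x ≠ ⊥ := by
    intro x hx
    have i : ι := Classical.arbitrary ι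
    have := (h x (inner ℝ x (a i) + c i - 1)).1 (by simp [hx]) i
    linarith
  refine ⟨hbot, hp, ?_, ?_⟩
  · rw [lowerSemicontinuous_iff_isClosed_preimage]
    intro t
    induction t with
    | bot =>
      convert isClosed_empty
      ext x
      simp [hbot x]
    | top => simp
    | coe t =>
      have : g ⁻¹' Set.Iic (t : EReal) = ⋂ i, {p | inner ℝ p (a i) + c i ≤ t} := by
        ext p
        simp [h]
      rw [this]
      exact isClosed_iInter fun i => isClosed_le (by fun_prop) continuous_const
  · intro p hp q hq α β hα hβ hαβ
    have hp' := (h _ _).1 hp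
    have hq' := (h _ _).1 hq
    refine (h _ _).2 fun i => ?_
    have h1 := mul_le_mul_of_nonneg_left (hp' i) hα
    have h2 := mul_le_mul_of_nonneg_left (hq' i) hβ
    have h3 : c i = α * c i + β * c i := by rw [← add_mul, hαβ, one_mul]
    simp only [WithLp.add_fst, WithLp.smul_fst, WithLp.add_snd, WithLp.smul_snd, inner_add_left,
      real_inner_smul_left, smul_eq_mul]
    linarith

theorem proj_closure_dom_spec [CompleteSpace E] {g : E → EReal} (hg : Gamma0 g) (x : E) :
    proj (closure (dom g)) x ∈ closure (dom g) ∧ ∀ y ∈ closure (dom g),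
      inner ℝ (x - proj (closure (dom g)) x) (y - proj (closure (dom g)) x) ≤ 0 :=
  proj_spec hg.proper.closure isClosed_closure hg.convex_dom.closure x

theorem proj_closure_dom_eq {g : E → EReal} {x p : E} (hp : p ∈ dom g)
    (h : ∀ y ∈ dom g, inner ℝ (x - p) (y - p) ≤ 0) : proj (closure (dom g)) x = p := by
  refine proj_eq (subset_closure hp) fun y hy => ?_
  have hcl : IsClosed {y : E | inner ℝ (x - p) (y - p) ≤ 0} :=
    isClosed_le (by fun_prop) continuous_const
  exact closure_minimal (s := dom g) h hcl hy

/-! ### Resolvents -/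

/-- `p = prox_{c g} x` and `g p = r`, expressed by the variational inequality
`(x - p) / c ∈ ∂g(p)`. -/
structure IsResolvent (g : E → EReal) (c : ℝ) (x p : E) (r : ℝ) : Prop where
  val : g p = r
  inner_le : ∀ (y : E) (s : ℝ), g y ≤ s → inner ℝ (x - p) (y - p) ≤ c * (s - r)

/-- Expanding the square, the variational inequality gains a term ‖y - p‖² / 2, so p is the only
minimizer and the choice made by `prox` must be p. -/
theorem IsResolvent.prox_eq {g : E → EReal} (hbot : ∀ y, g y ≠ ⊥) {c : ℝ} (hc : 0 < c)
    {x p : E} {r : ℝ} (h : IsResolvent g c x p r) : prox (scale c g) x = p := by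
  have key : ∀ (y : E) (s : ℝ), g y = s →
      c * r + 1 / 2 * ‖x - p‖ ^ 2 + 1 / 2 * ‖y - p‖ ^ 2 ≤ c * s + 1 / 2 * ‖x - y‖ ^ 2 := by
    intro y s hs
    have h1 := h.inner_le y s hs.le
    have h2 := norm_sub_sq_real (x - p) (y - p)
    rw [sub_sub_sub_cancel_right] at h2
    linarith
  have hmin : ∀ y : E, scale c g p + ((1 / 2 * ‖x - p‖ ^ 2 : ℝ) : EReal) ≤
      scale c g y + ((1 / 2 * ‖x - y‖ ^ 2 : ℝ) : EReal) := by
    intro y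
    by_cases hy : g y < ⊤
    · obtain ⟨s, hs⟩ := exists_real_of_lt_top (hbot y) hy
      rw [scale, scale, h.val, hs]
      norm_cast
      have := key y s hs
      nlinarith [sq_nonneg ‖y - p‖]
    · rw [not_lt_top_iff] at hy
      rw [scale, scale, hy, EReal.coe_mul_top_of_pos hc, EReal.top_add_coe]
      exact le_top
  have h3 := Classical.epsilon_spec (p := fun p : E => ∀ y : E,
    scale c g p + ((1 / 2 * ‖x - p‖ ^ 2 : ℝ) : EReal) ≤
      scale c g y + ((1 / 2 * ‖x - y‖ ^ 2 : ℝ) : EReal)) ⟨p, hmin⟩ p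
  change scale c g (prox (scale c g) x) + ((1 / 2 * ‖x - prox (scale c g) x‖ ^ 2 : ℝ) : EReal) ≤ _
    at h3
  set q := prox (scale c g) x
  have hq : g q < ⊤ := by
    rw [lt_top_iff_ne_top]
    intro hq
    rw [scale, scale, hq, EReal.coe_mul_top_of_pos hc, h.val, EReal.top_add_coe] at h3
    norm_cast at h3
  obtain ⟨s, hs⟩ := exists_real_of_lt_top (hbot q) hq
  have h4 := key q s hs
  rw [scale, scale, hs, h.val] at h3
  norm_cast at h3
  have h6 : ‖q - p‖ ^ 2 = 0 := le_antisymm (by linarith) (sq_nonneg _)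
  exact sub_eq_zero.1 (norm_eq_zero.1 (pow_eq_zero_iff two_ne_zero |>.1 h6))

theorem IsResolvent.unique {g : E → EReal} (hbot : ∀ y, g y ≠ ⊥) {c : ℝ} (hc : 0 < c)
    {x p q : E} {r s : ℝ} (h : IsResolvent g c x p r) (h' : IsResolvent g c x q s) :
    p = q ∧ r = s := by
  have hpq : p = q := (h.prox_eq hbot hc).symm.trans (h'.prox_eq hbot hc)
  refine ⟨hpq, ?_⟩
  have := h.val.symm.trans (hpq ▸ h'.val)
  exact_mod_cast this

/-- The value of `g` at `prox_{c g} x` is nonincreasing in `c`. -/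
theorem IsResolvent.antitone {g : E → EReal} {c c' : ℝ} (hc : 0 < c) (hcc : c < c')
    {x p q : E} {r s : ℝ} (h : IsResolvent g c x p r) (h' : IsResolvent g c' x q s) : s ≤ r := by
  have h1 := h.inner_le q s h'.val.le
  have h2 := h'.inner_le p r h.val.le
  have e : inner ℝ (x - q) (p - q) = ‖q - p‖ ^ 2 - inner ℝ (x - p) (q - p) := by
    rw [← real_inner_self_eq_norm_sq]
    simp only [inner_sub_left, inner_sub_right]
    ring
  rw [e] at h2
  have hn := sq_nonneg ‖q - p‖
  -- Weighting `h1` by c' and `h2` by c cancels the values r and s and leaves (c' - c)⟨x - p, q - p⟩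
  -- + c‖q - p‖² ≤ 0.
  have h3 : inner ℝ (x - p) (q - p) ≤ 0 := by
    by_contra hpos
    rw [not_le] at hpos
    nlinarith [mul_le_mul_of_nonneg_left h1 (hc.trans hcc).le,
      mul_le_mul_of_nonneg_left h2 hc.le, mul_pos (sub_pos.2 hcc) hpos, mul_nonneg hc.le hn]
  by_contra hlt
  rw [not_le] at hlt
  nlinarith [mul_pos (hc.trans hcc) (sub_pos.2 hlt)]

/-- Dependence of `prox_{c g} x` on `c`. -/
theorem IsResolvent.norm_sub_le {g : E → EReal} {c c' : ℝ} (hc : 0 < c) (hc' : 0 < c')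
    {x p q : E} {r s : ℝ} (h : IsResolvent g c x p r) (h' : IsResolvent g c' x q s) :
    ‖p - q‖ ≤ |c - c'| / c' * ‖x - q‖ := by
  have h1 := h.inner_le q s h'.val.le
  have h2 := h'.inner_le p r h.val.le
  have e : inner ℝ (x - p) (q - p) = ‖p - q‖ ^ 2 - inner ℝ (x - q) (p - q) := by
    rw [← real_inner_self_eq_norm_sq]
    simp only [inner_sub_left, inner_sub_right]
    ring
  rw [e] at h1
  have h3 : c' * ‖p - q‖ ^ 2 ≤ (c' - c) * inner ℝ (x - q) (p - q) := by
    nlinarith [mul_le_mul_of_nonneg_left h1 hc'.le, mul_le_mul_of_nonneg_left h2 hc.le]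
  have h4 : (c' - c) * inner ℝ (x - q) (p - q) ≤ |c - c'| * (‖x - q‖ * ‖p - q‖) := by
    rw [abs_sub_comm]
    refine (le_abs_self _).trans ?_
    rw [abs_mul]
    exact mul_le_mul_of_nonneg_left (abs_real_inner_le_norm _ _) (abs_nonneg _)
  rcases (norm_nonneg (p - q)).eq_or_lt with h0 | h0
  · rw [← h0]; positivity
  · rw [div_mul_eq_mul_div, le_div_iff₀ hc']
    refine le_of_mul_le_mul_right ?_ h0
    linarith

/-- Adding the two variational inequalities gives ‖P - p‖² ≤ c (s - r). With P the projection onto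
the closed domain, this bounds both the initial right end point and the root ν. -/
theorem IsResolvent.le_of_normal {g : E → EReal} {c : ℝ} (hc : 0 < c) {x p P : E} {r s : ℝ}
    (h : IsResolvent g c x p r) (hP : ∀ y ∈ dom g, inner ℝ (x - P) (y - P) ≤ 0) (hs : g P ≤ s) :
    r ≤ s := by
  have h1 := h.inner_le P s hs
  have h2 := hP p (mem_dom_of_le h.val.le)
  have e : inner ℝ (x - p) (P - p) = ‖P - p‖ ^ 2 - inner ℝ (x - P) (p - P) := by
    rw [← real_inner_self_eq_norm_sq]
    simp only [inner_sub_left, inner_sub_right]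
    ring
  rw [e] at h1
  by_contra hlt
  rw [not_le] at hlt
  nlinarith [mul_pos hc (sub_pos.2 hlt), sq_nonneg ‖P - p‖]

/-! ### Projections onto epigraphs -/

theorem inner_epi (z a y : E) (δ r s : ℝ) :
    inner ℝ ((WithLp.toLp 2 (z, δ) : WithLp 2 (E × ℝ)) - WithLp.toLp 2 (a, r))
      ((WithLp.toLp 2 (y, s) : WithLp 2 (E × ℝ)) - WithLp.toLp 2 (a, r)) =
    inner ℝ (z - a) (y - a) + (δ - r) * (s - r) := by
  rw [WithLp.prod_inner_apply]
  simp [mul_comm]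

/-- The projection of `(z, δ)` onto the epigraph of `g` is either vertical-free, or a resolvent
whose parameter is the increase of the last coordinate. -/
theorem exists_proj_epi [CompleteSpace E] {g : E → EReal} (hg : Gamma0 g) (z : E) (δ : ℝ) :
    ∃ (a : E) (r : ℝ), proj (epi g) (WithLp.toLp 2 (z, δ)) = WithLp.toLp 2 (a, r) ∧
      ((r = δ ∧ g a ≤ δ ∧ ∀ y ∈ dom g, inner ℝ (z - a) (y - a) ≤ 0) ∨
        (δ < r ∧ IsResolvent g (r - δ) z a r)) := by
  obtain ⟨y₀, s₀, h₀⟩ := hg.exists_le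
  obtain ⟨hmem, hle⟩ := proj_spec (C := epi g) ⟨WithLp.toLp 2 (y₀, s₀), h₀⟩ hg.isClosed_epi
    hg.convex (WithLp.toLp 2 (z, δ))
  generalize proj (epi g) (WithLp.toLp 2 (z, δ)) = P at hmem hle
  obtain ⟨⟨a, r⟩⟩ := P
  have hle' : ∀ (y : E) (s : ℝ), g y ≤ s → inner ℝ (z - a) (y - a) + (δ - r) * (s - r) ≤ 0 := by
    intro y s hy
    rw [← inner_epi]
    exact hle (WithLp.toLp 2 (y, s)) hy
  have ha : g a ≤ r := hmem
  obtain ⟨r', hr', hrr⟩ := exists_real_of_le (hg.ne_bot a) ha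
  -- Epigraphs are closed upwards, so (a, r + 1) is an admissible test point.
  have h1 : δ ≤ r := by
    have := hle' a (r + 1) (ha.trans (by norm_cast; linarith))
    simp at this
    linarith
  refine ⟨a, r, rfl, ?_⟩
  rcases h1.eq_or_lt with h1 | h1
  · subst h1
    refine .inl ⟨rfl, ha, fun y hy => ?_⟩
    obtain ⟨s, hs⟩ := exists_real_of_lt_top (hg.ne_bot y) hy
    simpa using hle' y s hs.le
  · refine .inr ⟨h1, ?_, fun y s hy => ?_⟩
    · have := hle' a r' hr'.le
      simp only [sub_self, inner_zero_right, zero_add] at this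
      have : r ≤ r' := by nlinarith
      rw [hr', le_antisymm hrr this]
    · linarith [hle' y s hy]

/-! ### Conjugates -/

theorem conj_le_iff {g : E → EReal} (hbot : ∀ y, g y ≠ ⊥) {u : E} {b : ℝ} :
    conj g u ≤ b ↔ ∀ (y : E) (s : ℝ), g y ≤ s → inner ℝ y u - s ≤ b := by
  rw [conj, iSup_le_iff]
  refine forall_congr' fun y => ?_
  by_cases hy : g y < ⊤
  · obtain ⟨r, hr⟩ := exists_real_of_lt_top (hbot y) hy
    rw [hr]
    norm_cast
    exact ⟨fun h s hs => by linarith, fun h => h r le_rfl⟩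
  · rw [not_lt_top_iff] at hy
    simp [hy]

/-- Project a point one unit below the graph onto the epigraph: the last coordinate must rise, and
the resulting resolvent gives a subgradient. -/
theorem exists_affine_minorant [CompleteSpace E] {g : E → EReal} (hg : Gamma0 g) :
    ∃ (u : E) (b : ℝ), ∀ (y : E) (s : ℝ), g y ≤ s → inner ℝ y u - s ≤ b := by
  obtain ⟨z, hz⟩ := hg.proper
  obtain ⟨t, ht⟩ := exists_real_of_lt_top (hg.ne_bot z) hz
  obtain ⟨a, r, -, h⟩ := exists_proj_epi hg z (t - 1)
  rcases h with ⟨-, ha, h⟩ | ⟨hr, h⟩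
  · have := h z hz
    rw [real_inner_self_nonpos, sub_eq_zero] at this
    rw [← this, ht] at ha
    norm_cast at ha
    linarith
  · have hc : 0 < r - (t - 1) := sub_pos.2 hr
    refine ⟨(r - (t - 1))⁻¹ • (z - a), (r - (t - 1))⁻¹ * inner ℝ (z - a) a - r, fun y s hs => ?_⟩
    have := mul_le_mul_of_nonneg_left (h.inner_le y s hs) (inv_nonneg.2 hc.le)
    rw [inv_mul_cancel_left₀ hc.ne', inner_sub_right] at this
    rw [real_inner_smul_right, real_inner_comm]
    linarith

theorem gamma0_conj [CompleteSpace E] {g : E → EReal} (hg : Gamma0 g) : Gamma0 (conj g) := by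
  obtain ⟨y₀, s₀, h₀⟩ := hg.exists_le
  have : Nonempty {p : E × ℝ // g p.1 ≤ p.2} := ⟨⟨(y₀, s₀), h₀⟩⟩
  refine Gamma0.of_le_iff (ι := {p : E × ℝ // g p.1 ≤ p.2}) (fun p => p.1.1) (fun p => -p.1.2)
    (fun u b => ?_) ?_
  · rw [conj_le_iff hg.ne_bot]
    refine ⟨fun h i => ?_, fun h y s hs => ?_⟩
    · rw [real_inner_comm]
      exact h _ _ i.2
    · rw [real_inner_comm]
      exact h ⟨(y, s), hs⟩
  · obtain ⟨u, b, h⟩ := exists_affine_minorant hg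
    exact ⟨u, mem_dom_of_le ((conj_le_iff hg.ne_bot).2 h)⟩

/-- The nontrivial half of the Fenchel–Moreau theorem. -/
theorem le_of_forall_conj [CompleteSpace E] {g : E → EReal} (hg : Gamma0 g) {z : E} {t : ℝ}
    (h : ∀ (u : E) (b : ℝ), conj g u ≤ b → inner ℝ z u - b ≤ t) : g z ≤ t := by
  obtain ⟨a, r, -, hp⟩ := exists_proj_epi hg z t
  rcases hp with ⟨-, ha, hp⟩ | ⟨hr, hp⟩
  · obtain ⟨u, b, hu⟩ := exists_affine_minorant hg
    rcases eq_or_ne z a with rfl | hne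
    · exact ha
    have hpos : 0 < ‖z - a‖ ^ 2 := by
      have := norm_pos_iff.2 (sub_ne_zero.2 hne)
      positivity
    exfalso
    -- Here z - a separates z from the domain by a vertical hyperplane. Tilting an affine minorant
    -- by c (z - a) keeps it a minorant, while its value at z grows without bound.
    have key : ∀ c : ℝ, 0 ≤ c → inner ℝ z u - b + c * ‖z - a‖ ^ 2 ≤ t := by
      intro c hc
      have := h (u + c • (z - a)) (b + c * inner ℝ (z - a) a) <|
        (conj_le_iff hg.ne_bot).2 fun y s hs => by
          have h1 := hu y s hs
          have h2 := mul_le_mul_of_nonneg_left (hp y (mem_dom_of_le hs)) hc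
          rw [inner_sub_right] at h2
          rw [inner_add_right, real_inner_smul_right, real_inner_comm (z - a) y]
          linarith
      rw [inner_add_right, real_inner_smul_right, real_inner_comm (z - a) z] at this
      rw [← real_inner_self_eq_norm_sq, inner_sub_right (z - a) z a]
      linarith
    have := key ((|t - (inner ℝ z u - b)| + 1) / ‖z - a‖ ^ 2) (by positivity)
    rw [div_mul_cancel₀ _ hpos.ne'] at this
    linarith [le_abs_self (t - (inner ℝ z u - b))]
  · exfalso
    have hc : 0 < r - t := sub_pos.2 hr
    have := h ((r - t)⁻¹ • (z - a)) ((r - t)⁻¹ * inner ℝ (z - a) a - r) <|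
      (conj_le_iff hg.ne_bot).2 fun y s hs => by
        have := mul_le_mul_of_nonneg_left (hp.inner_le y s hs) (inv_nonneg.2 hc.le)
        rw [inv_mul_cancel_left₀ hc.ne', inner_sub_right] at this
        rw [real_inner_smul_right, real_inner_comm]
        linarith
    rw [real_inner_smul_right, real_inner_comm] at this
    have h2 : 0 ≤ (r - t)⁻¹ * inner ℝ (z - a) (z - a) :=
      mul_nonneg (inv_nonneg.2 hc.le) real_inner_self_nonneg
    rw [inner_sub_right (z - a) z a] at h2
    linarith

/-- Moreau's decomposition. -/
theorem IsResolvent.conj {g : E → EReal} (hbot : ∀ y, g y ≠ ⊥) {c : ℝ} (hc : 0 < c)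
    {x q u : E} {r : ℝ} (h : IsResolvent g c x q r) (hu : c • u = x - q) :
    IsResolvent (conj g) c⁻¹ (c⁻¹ • x) u (inner ℝ q u - r) := by
  have hle : EpiPersp.conj g u ≤ ((inner ℝ q u - r : ℝ) : EReal) := by
    refine (conj_le_iff hbot).2 fun y s hs => ?_
    have h1 := h.inner_le y s hs
    rw [← hu, real_inner_smul_left] at h1
    have h2 := le_of_mul_le_mul_left h1 hc
    rw [inner_sub_right, real_inner_comm y u, real_inner_comm q u] at h2
    linarith
  have hge : ∀ (v : E) (b : ℝ), EpiPersp.conj g v ≤ b → inner ℝ q v - r ≤ b :=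
    fun v b hb => (conj_le_iff hbot).1 hb q r h.val.le
  refine ⟨le_antisymm hle ?_, fun v b hb => ?_⟩
  · refine EReal.le_of_forall_lt_iff_le.1 fun b hb => ?_
    exact_mod_cast hge u b hb.le
  · have e : c⁻¹ • x - u = c⁻¹ • q := by
      have : x = c • u + q := by rw [hu]; abel
      rw [this, smul_add, inv_smul_smul₀ hc.ne']
      abel
    rw [e, real_inner_smul_left, inner_sub_right]
    refine mul_le_mul_of_nonneg_left ?_ (inv_nonneg.2 hc.le)
    linarith [hge v b hb]

/-! ### Existence of resolvents -/

/-- A minimizing sequence is Cauchy by the parallelogram law; the variational inequality is the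
first-order condition at its limit. -/
theorem exists_isResolvent [CompleteSpace E] {g : E → EReal} (hg : Gamma0 g) {c : ℝ} (hc : 0 < c)
    (x : E) : ∃ (p : E) (r : ℝ), IsResolvent g c x p r := by
  let J : E → ℝ → ℝ := fun y s => c * s + 1 / 2 * ‖x - y‖ ^ 2
  let S : Set ℝ := {t | ∃ y s, g y ≤ (s : ℝ) ∧ t = J y s}
  obtain ⟨y₀, s₀, h₀⟩ := hg.exists_le
  have hne : S.Nonempty := ⟨_, y₀, s₀, h₀, rfl⟩
  have hbdd : BddBelow S := by
    obtain ⟨u, b, hu⟩ := exists_affine_minorant hg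
    -- Insert the affine minorant and complete the square.
    refine ⟨c * (inner ℝ x u - b) - 1 / 2 * ‖c • u‖ ^ 2, ?_⟩
    rintro _ ⟨y, s, hs, rfl⟩
    have h1 := mul_le_mul_of_nonneg_left (hu y s hs) hc.le
    have h2 := sq_nonneg ‖(x - y) - c • u‖
    rw [norm_sub_sq_real, real_inner_smul_right, inner_sub_left] at h2
    simp only [J]
    linarith
  set m := sInf S
  have hm : ∀ y (s : ℝ), g y ≤ s → m ≤ J y s := fun y s hs => csInf_le hbdd ⟨y, s, hs, rfl⟩
  have hseq : ∀ n : ℕ, ∃ y s, g y ≤ (s : ℝ) ∧ J y s < m + 1 / ((n : ℝ) + 1) := by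
    intro n
    obtain ⟨_, ⟨y, s, hs, rfl⟩, hlt⟩ := exists_lt_of_csInf_lt hne
      (show sInf S < m + 1 / ((n : ℝ) + 1) from lt_add_of_pos_right _ (by positivity))
    exact ⟨y, s, hs, hlt⟩
  choose y s hys hJ using hseq
  have hmid : ∀ n k, ‖y n - y k‖ ^ 2 ≤ 4 * (1 / ((n : ℝ) + 1) + 1 / ((k : ℝ) + 1)) := by
    intro n k
    have h1 := hm _ _ (hg.convex_comb (hys n) (hys k) (a := 1 / 2) (b := 1 / 2) (by norm_num)
      (by norm_num) (by norm_num))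
    have h2 := hJ n
    have h3 := hJ k
    simp only [J] at h1 h2 h3
    have e : x - ((1 / 2 : ℝ) • y n + (1 / 2 : ℝ) • y k) =
        (1 / 2 : ℝ) • ((x - y n) + (x - y k)) := by module
    have e2 := parallelogram_law_with_norm ℝ (x - y n) (x - y k)
    have e3 : x - y n - (x - y k) = -(y n - y k) := by abel
    rw [e, norm_smul, mul_pow] at h1
    rw [e3, norm_neg] at e2
    norm_num at h1
    nlinarith
  have hlim0 : Tendsto (fun n : ℕ => 1 / ((n : ℝ) + 1)) atTop (𝓝 0) :=
    tendsto_one_div_add_atTop_nhds_zero_nat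
  have hcauchy : CauchySeq y := by
    refine cauchySeq_of_le_tendsto_0 (fun n => √(4 * (1 / ((n : ℝ) + 1) + 1 / ((n : ℝ) + 1)))) ?_ ?_
    · intro n k l hn hk
      rw [dist_eq_norm]
      refine Real.le_sqrt_of_sq_le ((hmid n k).trans ?_)
      have h1 : (l : ℝ) ≤ n := by exact_mod_cast hn
      have h2 : (l : ℝ) ≤ k := by exact_mod_cast hk
      gcongr
    · have := ((hlim0.add hlim0).const_mul 4).sqrt
      simpa using this
  obtain ⟨p, hp⟩ := cauchySeq_tendsto_of_complete hcauchy
  have hJm : Tendsto (fun n => J (y n) (s n)) atTop (𝓝 m) := by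
    refine tendsto_of_tendsto_of_tendsto_of_le_of_le tendsto_const_nhds
      (by simpa using hlim0.const_add m) (fun n => hm _ _ (hys n)) fun n => (hJ n).le
  -- This height makes J p r = m; the heights s n converge to it because J (y n) (s n) and y n
  -- converge.
  obtain ⟨r, hr⟩ : ∃ r, r = c⁻¹ * (m - 1 / 2 * ‖x - p‖ ^ 2) := ⟨_, rfl⟩
  have hs : Tendsto s atTop (𝓝 r) := by
    have h1 : Tendsto (fun n => c⁻¹ * (J (y n) (s n) - 1 / 2 * ‖x - y n‖ ^ 2)) atTop (𝓝 r) := by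
      rw [hr]
      exact (hJm.sub ((((tendsto_const_nhds.sub hp).norm).pow 2).const_mul _)).const_mul _
    refine h1.congr fun n => ?_
    simp only [J]
    field_simp
    ring
  have hpr : g p ≤ r := by
    have h1 : Tendsto (fun n => (WithLp.toLp 2 (y n, s n) : WithLp 2 (E × ℝ))) atTop
        (𝓝 (WithLp.toLp 2 (p, r))) :=
      ((WithLp.prod_continuous_toLp 2 E ℝ).tendsto _).comp (hp.prodMk_nhds hs)
    exact hg.isClosed_epi.mem_of_tendsto h1 (Eventually.of_forall hys)
  have hmr : m = J p r := by
    simp only [J, hr]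
    field_simp
    ring
  have hineq : ∀ (z : E) (b : ℝ), g z ≤ b → inner ℝ (x - p) (z - p) ≤ c * (b - r) := by
    intro z b hz
    have h1 : ∀ t ∈ Set.Ioc (0 : ℝ) 1,
        inner ℝ (x - p) (z - p) ≤ c * (b - r) + t * (1 / 2 * ‖z - p‖ ^ 2) := by
      rintro t ⟨ht0, ht1⟩
      have h2 := hm _ _ (hg.convex_comb hpr hz (sub_nonneg.2 ht1) ht0.le (by ring))
      have e : x - ((1 - t) • p + t • z) = (x - p) - t • (z - p) := by module
      rw [hmr] at h2
      simp only [J] at h2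
      rw [e, norm_sub_sq_real (x - p), norm_smul, real_inner_smul_right, mul_pow, Real.norm_eq_abs,
        sq_abs] at h2
      refine le_of_mul_le_mul_left ?_ ht0
      nlinarith
    have h3 : Tendsto (fun t : ℝ => c * (b - r) + t * (1 / 2 * ‖z - p‖ ^ 2)) (𝓝[>] 0)
        (𝓝 (c * (b - r))) := by
      have : Continuous fun t : ℝ => c * (b - r) + t * (1 / 2 * ‖z - p‖ ^ 2) := by fun_prop
      simpa using (this.tendsto 0).mono_left nhdsWithin_le_nhds
    exact ge_of_tendsto h3 (by
      filter_upwards [Ioc_mem_nhdsGT (zero_lt_one' ℝ)] with t ht using h1 t ht)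
  refine ⟨p, r, ?_, hineq⟩
  obtain ⟨r', hr', hrr⟩ := exists_real_of_le (hg.ne_bot p) hpr
  have := hineq p r' hr'.le
  rw [sub_self, inner_zero_right] at this
  have : r ≤ r' := by nlinarith
  rw [hr', le_antisymm hrr this]

end Hilbert

theorem coe_mul_le_iff {c : ℝ} (hc : 0 < c) {a : EReal} {t : ℝ} :
    (c : EReal) * a ≤ t ↔ a ≤ ((t / c : ℝ) : EReal) := by
  induction a with
  | bot => simp [EReal.coe_mul_bot_of_pos hc]
  | top => simp [EReal.coe_mul_top_of_pos hc]
  | coe a =>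
    norm_cast
    rw [le_div_iff₀ hc, mul_comm]

/-! ### Recession function, perspective and its proximity operator -/

section PerspectiveTheory

variable {H : Type*} [NormedAddCommGroup H] [InnerProductSpace ℝ H]

theorem persp_of_pos (f : H → EReal) (y : H) {s : ℝ} (hs : 0 < s) :
    persp f (WithLp.toLp 2 (y, s)) = (s : EReal) * f (s⁻¹ • y) :=
  if_pos hs

theorem persp_zero (f : H → EReal) (y : H) :
    persp f (WithLp.toLp 2 (y, 0)) = recession f y := by
  simp [persp]

theorem persp_of_neg (f : H → EReal) (y : H) {s : ℝ} (hs : s < 0) :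
    persp f (WithLp.toLp 2 (y, s)) = ⊤ := by
  simp [persp, hs.ne, hs.not_gt]

variable [CompleteSpace H]

/-- The recession function is the support function of the domain of the conjugate. -/
theorem tendsto_recession {f : H → EReal} (hf : Gamma0 f) (y : H) {x₀ : H} (hx₀ : x₀ ∈ dom f) :
    Tendsto (fun t : ℝ => (f (x₀ + t • y) - f x₀) / (t : EReal)) atTop
      (𝓝 (⨆ u ∈ dom (conj f), ((inner ℝ y u : ℝ) : EReal))) := by
  obtain ⟨a, ha⟩ := exists_real_of_lt_top (hf.ne_bot x₀) hx₀
  have hconj := gamma0_conj hf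
  rw [ha]
  refine tendsto_order.2 ⟨fun l hl => ?_, fun l hl => ?_⟩
  -- Lower bound: by Fenchel–Young, the quotient is at least ⟨y, u⟩ plus a constant over t.
  · obtain ⟨u, hu⟩ := lt_iSup_iff.1 hl
    obtain ⟨hu, hlu⟩ := lt_iSup_iff.1 hu
    obtain ⟨b, hb⟩ := exists_real_of_lt_top (hconj.ne_bot u) hu
    have h1 : Tendsto (fun t : ℝ => inner ℝ y u + (inner ℝ x₀ u - b - a) / t) atTop
        (𝓝 (inner ℝ y u)) := by
      simpa using (tendsto_const_nhds.div_atTop tendsto_id).const_add (inner ℝ y u)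
    have h2 := ((continuous_coe_real_ereal.tendsto _).comp h1).eventually (lt_mem_nhds hlu)
    filter_upwards [h2, eventually_gt_atTop 0] with t ht htpos
    refine ht.trans_le ?_
    have h3 : ((inner ℝ (x₀ + t • y) u - b : ℝ) : EReal) ≤ f (x₀ + t • y) := by
      refine EReal.le_of_forall_lt_iff_le.1 fun s hs => ?_
      have := (conj_le_iff hf.ne_bot).1 hb.le _ s hs.le
      norm_cast
      linarith
    have h4 := EReal.div_le_div_right_of_nonneg (c := (t : EReal)) (by exact_mod_cast htpos.le)
      (EReal.sub_le_sub h3 (le_refl (a : EReal)))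
    refine le_trans (le_of_eq ?_) h4
    rw [← EReal.coe_sub, ← EReal.coe_div, inner_add_left, real_inner_smul_left]
    refine congrArg Real.toEReal ?_
    field_simp
    ring
  -- Upper bound, valid for every t > 0: by Fenchel–Moreau, f (x₀ + t y) ≤ f x₀ + t s.
  · filter_upwards [eventually_gt_atTop 0] with t ht
    refine lt_of_le_of_lt ?_ hl
    refine EReal.le_of_forall_lt_iff_le.1 fun s hs => ?_
    have hs' : ∀ (u : H) (b : ℝ), conj f u ≤ b → inner ℝ y u ≤ s := by
      intro u b hb
      have := (le_iSup₂ (f := fun u (_ : u ∈ dom (conj f)) => ((inner ℝ y u : ℝ) : EReal)) u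
        (mem_dom_of_le hb)).trans hs.le
      exact_mod_cast this
    have h1 : f (x₀ + t • y) ≤ ((a + t * s : ℝ) : EReal) := by
      refine le_of_forall_conj hf fun u b hb => ?_
      have h2 := (conj_le_iff hf.ne_bot).1 hb _ a ha.le
      have h3 := mul_le_mul_of_nonneg_left (hs' u b hb) ht.le
      rw [inner_add_left, real_inner_smul_left]
      linarith
    have h4 := EReal.div_le_div_right_of_nonneg (c := (t : EReal)) (by exact_mod_cast ht.le)
      (EReal.sub_le_sub h1 (le_refl (a : EReal)))
    refine h4.trans (le_of_eq ?_)
    rw [← EReal.coe_sub, ← EReal.coe_div]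
    refine congrArg Real.toEReal ?_
    field_simp
    ring

theorem recession_eq_iSup {f : H → EReal} (hf : Gamma0 f) (y : H) :
    recession f y = ⨆ u ∈ dom (conj f), ((inner ℝ y u : ℝ) : EReal) := by
  obtain ⟨x₀, hx₀⟩ := hf.proper
  have h := Classical.epsilon_spec (p := fun l : EReal =>
    ∀ x₀ ∈ dom f, Tendsto (fun t : ℝ => (f (x₀ + t • y) - f x₀) / (t : EReal)) atTop (𝓝 l))
    ⟨_, fun _ h => tendsto_recession hf y h⟩
  exact tendsto_nhds_unique (h x₀ hx₀) (tendsto_recession hf y hx₀)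

theorem recession_le_iff {f : H → EReal} (hf : Gamma0 f) {y : H} {t : ℝ} :
    recession f y ≤ t ↔ ∀ (u : H) (b : ℝ), conj f u ≤ b → inner ℝ y u ≤ t := by
  rw [recession_eq_iSup hf, iSup₂_le_iff]
  refine forall_congr' fun u => ⟨fun h b hb => ?_, fun h hu => ?_⟩
  · exact_mod_cast h (mem_dom_of_le hb)
  · obtain ⟨b, hb⟩ := exists_real_of_lt_top ((gamma0_conj hf).ne_bot u) hu
    exact_mod_cast h b hb.le

/-- The perspective is the support function of `{(u, -b) | f* u ≤ b}`. -/
theorem persp_le_iff {f : H → EReal} (hf : Gamma0 f) {y : H} {s t : ℝ} :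
    persp f (WithLp.toLp 2 (y, s)) ≤ t ↔
      ∀ (u : H) (b : ℝ), conj f u ≤ b → inner ℝ y u - s * b ≤ t := by
  rcases lt_trichotomy s 0 with hs | rfl | hs
  · rw [persp_of_neg f y hs]
    refine ⟨fun h => absurd h (by simp), fun h => ?_⟩
    exfalso
    obtain ⟨u, b, hb⟩ := (gamma0_conj hf).exists_le
    have hpos : 0 < -s := neg_pos.2 hs
    -- For s < 0, raising b within epi f* makes -s b arbitrarily large.
    have := h u (b + (|t - (inner ℝ y u - s * b)| + 1) / -s) <| hb.trans <| by
      have : 0 ≤ (|t - (inner ℝ y u - s * b)| + 1) / -s := by positivity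
      exact_mod_cast le_add_of_nonneg_right this
    have e : s * ((|t - (inner ℝ y u - s * b)| + 1) / -s) =
        -(|t - (inner ℝ y u - s * b)| + 1) := by
      have := hs.ne
      field_simp
    rw [mul_add, e] at this
    linarith [le_abs_self (t - (inner ℝ y u - s * b))]
  · rw [persp_zero, recession_le_iff hf]
    simp
  · rw [persp_of_pos f y hs, coe_mul_le_iff hs]
    refine ⟨fun h u b hb => ?_, fun h => le_of_forall_conj hf fun u b hb => ?_⟩
    · have := mul_le_mul_of_nonneg_left ((conj_le_iff hf.ne_bot).1 hb _ _ h) hs.le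
      rw [real_inner_smul_left, mul_sub, mul_inv_cancel_left₀ hs.ne', mul_div_cancel₀ _ hs.ne']
        at this
      linarith
    · rw [real_inner_smul_left, le_div_iff₀ hs, sub_mul, mul_comm, mul_inv_cancel_left₀ hs.ne',
        mul_comm]
      exact h u b hb

theorem gamma0_persp {f : H → EReal} (hf : Gamma0 f) : Gamma0 (persp f) := by
  obtain ⟨u₀, b₀, h₀⟩ := (gamma0_conj hf).exists_le
  have : Nonempty {p : H × ℝ // conj f p.1 ≤ p.2} := ⟨⟨(u₀, b₀), h₀⟩⟩
  refine Gamma0.of_le_iff (ι := {p : H × ℝ // conj f p.1 ≤ p.2})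
    (fun p => WithLp.toLp 2 (p.1.1, -p.1.2)) (fun _ => 0) ?_ ?_
  · rintro ⟨⟨y, s⟩⟩ t
    rw [persp_le_iff hf]
    have e : ∀ (u : H) (b : ℝ), inner ℝ (WithLp.toLp 2 (y, s) : WithLp 2 (H × ℝ))
        (WithLp.toLp 2 (u, -b)) + 0 = inner ℝ y u - s * b := by
      intro u b
      rw [WithLp.prod_inner_apply]
      simp [mul_comm, sub_eq_add_neg]
    refine ⟨fun h i => ?_, fun h u b hb => ?_⟩
    · rw [e]
      exact h _ _ i.2
    · rw [← e]
      exact h ⟨(u, b), hb⟩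
  · obtain ⟨y, s, hs⟩ := hf.exists_le
    refine ⟨WithLp.toLp 2 (y, 1), mem_dom_of_le (s := s) ?_⟩
    rw [persp_of_pos f y one_pos]
    simpa using hs

theorem recession_ne_bot {f : H → EReal} (hf : Gamma0 f) (y : H) : recession f y ≠ ⊥ := by
  rw [← persp_zero]
  exact (gamma0_persp hf).ne_bot _

/-! ### The pair computed in one pass -/

theorem threshold_nonpos_iff {f : H → EReal} (hf : Gamma0 f) (x : H) (η : ℝ) {μ : ℝ}
    (hμ : 0 < μ) : threshold f x η μ ≤ 0 ↔
      conj f (proj (closure (dom (conj f))) (μ⁻¹ • x)) ≤ ((-η / μ : ℝ) : EReal) := by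
  rw [threshold, ← coe_mul_le_iff hμ]
  generalize hA : conj f (proj (closure (dom (conj f))) (μ⁻¹ • x)) = A
  have hA' : A ≠ ⊥ := hA ▸ (gamma0_conj hf).ne_bot _
  induction A with
  | bot => exact absurd rfl hA'
  | top => simp [EReal.coe_mul_top_of_pos hμ]
  | coe a =>
    norm_cast
    constructor <;> intro h <;> linarith

theorem psi_eq {f : H → EReal} (hf : Gamma0 f) {x u : H} {η μ ν r : ℝ} (hμ : 0 < μ) (hν : 0 < ν)
    (h : IsResolvent (conj f) (ν / μ) (μ⁻¹ • x) u r) :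
    psi f x η μ ν = ((ν - η - μ * r : ℝ) : EReal) := by
  rw [psi, h.prox_eq (gamma0_conj hf).ne_bot (div_pos hν hμ), h.val]
  norm_cast

/-- Project (x/μ, -η/μ) onto epi f*. Outside the first branch the last coordinate rises, and ν is μ
times the rise. -/
theorem exists_nuRoot {f : H → EReal} (hf : Gamma0 f) (x : H) (η : ℝ) {μ : ℝ} (hμ : 0 < μ)
    (h : ¬ threshold f x η μ ≤ 0) :
    ∃ ν : ℝ, 0 < ν ∧ (ν : EReal) ≤ threshold f x η μ ∧ psi f x η μ ν = 0 := by
  have hc := gamma0_conj hf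
  obtain ⟨a, r, -, hp⟩ := exists_proj_epi hc (μ⁻¹ • x) (-η / μ)
  rcases hp with ⟨-, ha, hn⟩ | ⟨hr, hp⟩
  · refine absurd ((threshold_nonpos_iff hf x η hμ).2 ?_) h
    rwa [proj_closure_dom_eq (mem_dom_of_le ha) hn]
  have hpos : 0 < r - -η / μ := sub_pos.2 hr
  have hν : μ * (r - -η / μ) = η + μ * r := by
    field_simp
    ring
  have hres : IsResolvent (conj f) (μ * (r - -η / μ) / μ) (μ⁻¹ • x) a r := by
    rwa [mul_div_cancel_left₀ _ hμ.ne']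
  refine ⟨μ * (r - -η / μ), mul_pos hμ hpos, ?_, ?_⟩
  · rw [hν, threshold]
    obtain ⟨-, hP⟩ := proj_closure_dom_spec hc (μ⁻¹ • x)
    generalize proj (closure (dom (conj f))) (μ⁻¹ • x) = P at hP
    by_cases htop : conj f P < ⊤
    · obtain ⟨s, hs⟩ := exists_real_of_lt_top (hc.ne_bot P) htop
      have := hp.le_of_normal hpos (fun y hy => hP y (subset_closure hy)) hs.le
      rw [hs]
      norm_cast
      gcongr
    · rw [not_lt_top_iff] at htop
      rw [htop, EReal.coe_mul_top_of_pos hμ, EReal.coe_add_top]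
      exact le_top
  · rw [psi_eq hf hμ (mul_pos hμ hpos) hres, hν]
    norm_cast
    ring

/-- Any positive zero serves below, so uniqueness of the zero need not be proved separately. -/
theorem nuRoot_spec {f : H → EReal} (hf : Gamma0 f) (x : H) (η : ℝ) {μ : ℝ} (hμ : 0 < μ)
    (h : ¬ threshold f x η μ ≤ 0) : 0 < nuRoot f x η μ ∧ psi f x η μ (nuRoot f x η μ) = 0 := by
  have := Classical.epsilon_spec (exists_nuRoot hf x η hμ h)
  exact ⟨this.1, this.2.2⟩

/-- `prox_{μ rec f} x = x - μ u` where `u` is the projection of `x / μ` onto `cl dom f*`. -/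
theorem isResolvent_recession {f : H → EReal} (hf : Gamma0 f) {x u : H} {μ b : ℝ} (hμ : 0 < μ)
    (hb : conj f u ≤ b) (hn : ∀ v ∈ dom (conj f), inner ℝ (μ⁻¹ • x - u) (v - u) ≤ 0) :
    IsResolvent (recession f) μ x (x - μ • u) (inner ℝ (x - μ • u) u) := by
  refine ⟨le_antisymm ((recession_le_iff hf).2 fun v c hc => ?_) ?_, fun y s hs => ?_⟩
  · have h1 := mul_le_mul_of_nonneg_left (hn v (mem_dom_of_le hc)) hμ.le
    rw [mul_zero, ← real_inner_smul_left, smul_sub, smul_inv_smul₀ hμ.ne', inner_sub_right] at h1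
    linarith
  · refine EReal.le_of_forall_lt_iff_le.1 fun s hs => ?_
    exact_mod_cast (recession_le_iff hf).1 hs.le u b hb
  · have := (recession_le_iff hf).1 hs u b hb
    rw [sub_sub_cancel, real_inner_smul_left]
    refine mul_le_mul_of_nonneg_left ?_ hμ.le
    rw [inner_sub_right, real_inner_comm y u, real_inner_comm (x - μ • u) u]
    linarith

theorem loopTest_eq_sub_persp {f : H → EReal} (hf : Gamma0 f) (x : H) (η δ : ℝ) {μ : ℝ} (hμ : 0 < μ) :
    loopTest f x η δ μ =
      ((μ + δ : ℝ) : EReal) - persp f (WithLp.toLp 2 (loopPoint f x η μ)) := by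
  unfold loopTest
  split_ifs with h
  · have : loopPoint f x η μ = ((loopPoint f x η μ).1, 0) := by
      simp [loopPoint, h]
    rw [this, persp_zero]
  · have h1 : (loopPoint f x η μ).2 = nuRoot f x η μ := by
      simp [loopPoint, h]
    rw [← persp_of_pos f _ (h1 ▸ (nuRoot_spec hf x η hμ h).1)]

/-- In both branches (x, η) minus the computed point is μ (u, -b) with f* u ≤ b, and this (u, -b)
attains the support function at that point: b = -η/μ in the first branch, b = f* u in the second. -/
theorem exists_isResolvent_loopPoint {f : H → EReal} (hf : Gamma0 f) (x : H) (η : ℝ) {μ : ℝ}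
    (hμ : 0 < μ) : ∃ r : ℝ, IsResolvent (persp f) μ (WithLp.toLp 2 (x, η))
      (WithLp.toLp 2 (loopPoint f x η μ)) r := by
  have hc := gamma0_conj hf
  by_cases h : threshold f x η μ ≤ 0
  · have hb := (threshold_nonpos_iff hf x η hμ).1 h
    obtain ⟨-, hn⟩ := proj_closure_dom_spec hc (μ⁻¹ • x)
    generalize proj (closure (dom (conj f))) (μ⁻¹ • x) = u at hb hn
    have hrec := isResolvent_recession hf hμ hb fun v hv => hn v (subset_closure hv)
    have hpt : loopPoint f x η μ = (x - μ • u, 0) := by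
      rw [loopPoint, if_pos h, hrec.prox_eq (recession_ne_bot hf) hμ]
    rw [hpt]
    refine ⟨inner ℝ (x - μ • u) u, by rw [persp_zero, hrec.val], ?_⟩
    rintro ⟨⟨y, s⟩⟩ t ht
    rw [inner_epi]
    have h1 := mul_le_mul_of_nonneg_left ((persp_le_iff hf).1 ht u _ hb) hμ.le
    have e : μ * (inner ℝ y u - s * (-η / μ)) = μ * inner ℝ y u + η * s := by
      field_simp
      ring
    rw [e] at h1
    rw [sub_sub_cancel, real_inner_smul_left, inner_sub_right, real_inner_comm y u,
      real_inner_comm (x - μ • u) u]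
    linarith
  · obtain ⟨hν, hψ⟩ := nuRoot_spec hf x η hμ h
    have hpt : loopPoint f x η μ = (nuRoot f x η μ •
        prox (scale (μ / nuRoot f x η μ) f) ((nuRoot f x η μ)⁻¹ • x), nuRoot f x η μ) := by
      rw [loopPoint, if_neg h]
    rw [hpt]
    generalize nuRoot f x η μ = ν at hν hψ
    obtain ⟨q, r, hq⟩ := exists_isResolvent hf (div_pos hμ hν) (ν⁻¹ • x)
    rw [hq.prox_eq hf.ne_bot (div_pos hμ hν)]
    obtain ⟨u, hu⟩ : ∃ u : H, (μ / ν) • u = ν⁻¹ • x - q :=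
      ⟨(μ / ν)⁻¹ • (ν⁻¹ • x - q), smul_inv_smul₀ (div_pos hμ hν).ne' _⟩
    have hcu := hq.conj hf.ne_bot (div_pos hμ hν) hu
    -- After this rescaling, Moreau's decomposition yields exactly the resolvent of f* that `psi`
    -- evaluates.
    have hx : (μ / ν)⁻¹ • ν⁻¹ • x = μ⁻¹ • x := by
      rw [smul_smul]
      congr 1
      field_simp
    rw [hx, inv_div] at hcu
    have hμu : x - ν • q = μ • u := by
      have := congrArg (ν • ·) hu
      simp only [smul_sub, smul_inv_smul₀ hν.ne', smul_smul, mul_div_cancel₀ _ hν.ne'] at this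
      exact this.symm
    rw [psi_eq hf hμ hν hcu] at hψ
    norm_cast at hψ
    refine ⟨ν * r, ?_, ?_⟩
    · rw [persp_of_pos f _ hν, inv_smul_smul₀ hν.ne', hq.val]
      norm_cast
    · rintro ⟨⟨y, s⟩⟩ t ht
      rw [inner_epi]
      have h1 := mul_le_mul_of_nonneg_left ((persp_le_iff hf).1 ht u _ hcu.val.le) hμ.le
      have e : η - ν = -(μ * (inner ℝ q u - r)) := by linarith
      rw [hμu, e, real_inner_smul_left, inner_sub_right, real_inner_smul_right,
        real_inner_comm y u, real_inner_comm q u]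
      linarith

end PerspectiveTheory

/-! ### Bisection and its error -/

section Bisection

variable {H : Type*} [NormedAddCommGroup H] [InnerProductSpace ℝ H]

/-- The natural floor sends negative logarithms to 0, and the logarithm is still below the floor
plus one. -/
theorem muInit_div_two_pow_le {f : H → EReal} {x : H} {η δ N ε : ℝ} (hε : 0 < ε)
    (hpos : 0 < muInit f x η δ N) :
    muInit f x η δ N / 2 ^ (lastIndex f x η δ N ε + 1) ≤ ε := by
  have h1 := Nat.lt_floor_add_one (Real.logb 2 (muInit f x η δ N / ε))
  rw [Real.logb_lt_iff_lt_rpow one_lt_two (div_pos hpos hε)] at h1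
  have h2 : muInit f x η δ N / ε < 2 ^ (lastIndex f x η δ N ε + 1) := by
    rw [← Real.rpow_natCast]
    push_cast
    exact h1
  rw [div_lt_iff₀ hε] at h2
  rw [div_le_iff₀ (by positivity)]
  linarith

variable [CompleteSpace H]

theorem phi_eq_loopTest {f : H → EReal} (hf : Gamma0 f) (x : H) (η δ : ℝ) {μ : ℝ} (hμ : 0 < μ) :
    phi f x η δ μ = loopTest f x η δ μ := by
  obtain ⟨r, hr⟩ := exists_isResolvent_loopPoint hf x η hμ
  rw [phi, hr.prox_eq (gamma0_persp hf).ne_bot hμ, loopTest_eq_sub_persp hf x η δ hμ]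

/-- The test of the loop locates `μ` relative to the zero `μs` of `φ`. -/
theorem loopTest_pos_iff {f : H → EReal} (hf : Gamma0 f) {x : H} {η δ μs μ : ℝ}
    {a : WithLp 2 (H × ℝ)} (hμs : 0 < μs)
    (hs : IsResolvent (persp f) μs (WithLp.toLp 2 (x, η)) a (δ + μs)) (hμ : 0 < μ) :
    0 < loopTest f x η δ μ ↔ μs < μ := by
  obtain ⟨r, hr⟩ := exists_isResolvent_loopPoint hf x η hμ
  rw [loopTest_eq_sub_persp hf x η δ hμ, hr.val]
  norm_cast
  rcases lt_trichotomy μs μ with h | rfl | h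
  · have := hs.antitone hμs h hr
    simp only [h, iff_true]
    linarith
  · have := (hr.unique (gamma0_persp hf).ne_bot hμ hs).2
    simp only [lt_irrefl, iff_false]
    linarith
  · have := hr.antitone hμ h hs
    simp only [h.not_gt, iff_false]
    linarith

theorem le_muInit {f : H → EReal} (hf : Gamma0 f) {x : H} {η δ μs N : ℝ} (hN : 1 < N)
    {a : WithLp 2 (H × ℝ)} (hμs : 0 < μs)
    (hs : IsResolvent (persp f) μs (WithLp.toLp 2 (x, η)) a (δ + μs)) :
    μs ≤ muInit f x η δ N := by
  have hg := gamma0_persp hf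
  unfold muInit
  split_ifs with h
  · obtain ⟨t, ht⟩ := exists_real_of_lt_top (hg.ne_bot _) h
    have hP := (proj_closure_dom_spec hg (WithLp.toLp 2 (x, η))).2
    have := hs.le_of_normal (P := projDom f x η) hμs (fun y hy => hP y (subset_closure hy)) ht.le
    rw [ht, EReal.toReal_coe]
    linarith
  · have hiff : ∀ k : ℕ, 0 < phi f x η δ (N ^ k) ↔ μs < N ^ k := by
      intro k
      have hk : 0 < N ^ k := pow_pos (one_pos.trans hN) k
      rw [phi_eq_loopTest hf x η δ hk, loopTest_pos_iff hf hμs hs hk]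
    obtain ⟨k, hk⟩ := pow_unbounded_of_one_lt μs hN
    -- As N > 1, the set is nonempty, so `sInf` is a true minimum and not its default value 0.
    have := Nat.sInf_mem (s := {k : ℕ | 0 < phi f x η δ (N ^ k)}) ⟨k, (hiff k).2 hk⟩
    exact ((hiff _).1 this).le

theorem bracket_spec {f : H → EReal} (hf : Gamma0 f) {x : H} {η δ μs N : ℝ} (hN : 1 < N)
    {a : WithLp 2 (H × ℝ)} (hμs : 0 < μs)
    (hs : IsResolvent (persp f) μs (WithLp.toLp 2 (x, η)) a (δ + μs)) (n : ℕ) :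
    0 ≤ (bracket f x η δ N n).1 ∧ (bracket f x η δ N n).1 ≤ μs ∧ μs ≤ (bracket f x η δ N n).2 ∧
      (bracket f x η δ N n).2 - (bracket f x η δ N n).1 = muInit f x η δ N / 2 ^ n := by
  induction n with
  | zero => exact ⟨le_rfl, hμs.le, le_muInit hf hN hμs hs, by simp [bracket]⟩
  | succ n ih =>
    obtain ⟨h1, h2, h3, h4⟩ := ih
    have hμ : 0 < ((bracket f x η δ N n).2 + (bracket f x η δ N n).1) / 2 := by linarith
    have hiff := loopTest_pos_iff hf hμs hs hμ
    rw [pow_succ, ← div_div, ← h4]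
    simp only [bracket]
    split_ifs with h
    · exact ⟨h1, h2, (hiff.1 h).le, by ring⟩
    · exact ⟨hμ.le, not_lt.1 (mt hiff.2 h), h3, by ring⟩

end Bisection

end EpiPersp

end

theorem mainTheorem4 {H : Type*} [NormedAddCommGroup H] [InnerProductSpace ℝ H] [CompleteSpace H]
    (f : H → EReal) (hf : EpiPersp.Gamma0 f)
    (x : H) (η δ : ℝ)
    (hδ : (δ : EReal) < EpiPersp.persp f
      (EpiPersp.proj (closure (EpiPersp.dom (EpiPersp.persp f))) (WithLp.toLp 2 (x, η))))
    (ε : ℝ) (hε : 0 < ε) (N : ℝ) (hN : 1 < N)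
    (xs : H) (ηs δs : ℝ)
    (hs : WithLp.toLp 2 (WithLp.toLp 2 (xs, ηs), δs) =
      EpiPersp.proj (EpiPersp.epi (EpiPersp.persp f)) (WithLp.toLp 2 (WithLp.toLp 2 (x, η), δ)))
    (xb : H) (ηb δb : ℝ)
    (hb : WithLp.toLp 2 (WithLp.toLp 2 (xb, ηb), δb) = EpiPersp.bisection f x η δ N ε) :
    |δs - δb| ≤ ε ∧
      ‖(WithLp.toLp 2 (xs, ηs) : WithLp 2 (H × ℝ)) - WithLp.toLp 2 (xb, ηb)‖ ≤
        ε / (δb - δ) *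
          ‖(WithLp.toLp 2 (x, η) : WithLp 2 (H × ℝ)) - WithLp.toLp 2 (xb, ηb)‖ := by
  open EpiPersp in
  obtain ⟨a, r, hproj, hp⟩ := exists_proj_epi (gamma0_persp hf) (WithLp.toLp 2 (x, η)) δ
  rw [hproj] at hs
  obtain ⟨rfl, rfl⟩ : WithLp.toLp 2 (xs, ηs) = a ∧ δs = r :=
    Prod.mk.inj (WithLp.toLp_injective 2 hs)
  rcases hp with ⟨-, ha, hn⟩ | ⟨hr, hp⟩
  · rw [proj_closure_dom_eq (mem_dom_of_le ha) hn] at hδ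
    exact absurd ha hδ.not_ge
  have hμs : 0 < δs - δ := sub_pos.2 hr
  have hp' : IsResolvent (persp f) (δs - δ) (WithLp.toLp 2 (x, η)) (WithLp.toLp 2 (xs, ηs))
      (δ + (δs - δ)) := by rwa [add_sub_cancel]
  have hinit := hμs.trans_le (le_muInit hf hN hμs hp')
  obtain ⟨h1, h2, h3, h4⟩ := bracket_spec hf hN hμs hp' (lastIndex f x η δ N ε)
  have h5 := muInit_div_two_pow_le hε hinit
  -- The midpoint is within half the last bracket of the zero, whence the exponent m + 1.
  rw [pow_succ, ← div_div, ← h4] at h5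
  obtain ⟨hxb, hδb⟩ : WithLp.toLp 2 (xb, ηb) =
      WithLp.toLp 2 (loopPoint f x η (midpt f x η δ N (lastIndex f x η δ N ε))) ∧
      δb = δ + midpt f x η δ N (lastIndex f x η δ N ε) :=
    Prod.mk.inj (WithLp.toLp_injective 2 hb)
  have hμ : 0 < midpt f x η δ N (lastIndex f x η δ N ε) := by
    unfold midpt
    linarith
  have herr : |δs - δ - midpt f x η δ N (lastIndex f x η δ N ε)| ≤ ε := by
    unfold midpt
    rw [abs_le]
    constructor <;> linarith
  obtain ⟨s, hres⟩ := exists_isResolvent_loopPoint hf x η hμ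
  rw [hxb, hδb, add_sub_cancel_left, ← sub_sub]
  refine ⟨herr, (hp'.norm_sub_le hμs hμ hres).trans ?_⟩
  gcongr
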